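/- Let $k$ be an algebraically closed field of characteristic $0$, let $(X,\Lambda_0)$ be a nonsingular projective Poisson variety over $k$ (with bracket $\{-,-\}$ on $\mathcal{O}_X$), and let $(L,\nabla)$ be a Poisson invertible sheaf on it, i.e. an invertible sheaf with a flat Poisson connection, a $k$-bilinear bracket $\{a,s\}=\nabla(s)(a)$ of functions with sections of $L$. Choose an affine open covering $\{U_i\}$ of $X$ and frames $e_i$ of $L|_{U_i}$, and let $f_{ij}$ and $T_i$ be the transition functions and vector fields with $e_j=f_{ij}e_i$ and $\{a,e_i\}=T_i(a)e_i$; thus the coordinates of a section satisfy $s_i=f_{ij}s_j$. Brackets $[-,-]$ of polyvector fields are Schouten brackets. Let $L^\bullet$ be the complex $L\xrightarrow{\nabla}T_X\otimes L\xrightarrow{v_1}\wedge^2T_X\otimes L\to\cdots$, where $T_X\otimes L=Der(\mathcal{O}_X,L)$ and $v_1(\delta)(a,b)=\{a,\delta(b)\}-\{b,\delta(a)\}-\delta(\{a,b\})$. Let $\mathcal{E}_L^\bullet$ be the complex whose $p$-th term has as sections the systems $(a_i,b_i)$ of sections of $\wedge^pT_X\oplus\wedge^{p+1}T_X$ over the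 $U_i$ with $b_i=b_j$ and $a_j-a_i=f_{ij}^{-1}[b_i,f_{ij}]$, and with differential $(a_i,b_i)\mapsto([\Lambda_0,a_i]+(-1)^{p+1}[T_i,b_i],[\Lambda_0,b_i])$. Hypercohomology is computed by the Čech complexes of $\{U_i\}$; in particular $\mathbb{H}^0(X,\Lambda_0,L^\bullet,\nabla)$ is the group of global sections $s$ of $L$ with $\nabla s=0$. The rule $(a_i,b_i)\mapsto(s\mapsto (s_ia_i+[b_i,s_i])\,e_i)$ induces $$M_1:\mathbb{H}^1(X,\Lambda_0,\mathcal{E}_L^\bullet)\to \mathrm{Hom}\big(\mathbb{H}^0(X,\Lambda_0,L^\bullet,\nabla),\mathbb{H}^1(X,\Lambda_0,L^\bullet,\nabla)\big).$$ Let $(\mathcal{X},\Lambda,\mathcal{L},\nabla_{\mathcal{L}})$ be a first-order deformation of $(X,\Lambda_0,L,\nabla)$: a flat Poisson scheme $(\mathcal{X},\Lambda)$ over $\mathrm{Spec}\,k[\epsilon]$ and an invertible sheaf $\mathcal{L}$ on it with a $k[\epsilon]$-bilinear flat Poisson connection $\nabla_{\mathcal{L}}$, together with an identification of its restriction to the closed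 fibre with $(X,\Lambda_0,L,\nabla)$. Suppose that it is defined by the class $\eta\in\mathbb{H}^1(X,\Lambda_0,\mathcal{E}_L^\bullet)$. This means that there are trivialisations $\theta_i:\mathcal{O}_{\mathcal{X}}|_{U_i}\cong\mathcal{O}_{U_i}[\epsilon]$ of sheaves of $k[\epsilon]$-algebras, inducing the identity modulo $\epsilon$, and frames $E_i$ of $\mathcal{L}|_{U_i}$ lifting $e_i$, in which $\Lambda$ is $\Lambda_0+\epsilon\Lambda_i$, $\nabla_{\mathcal{L}}$ is given by $T_i+\epsilon W_i$, $\theta_i\theta_j^{-1}=\mathrm{Id}+\epsilon p_{ij}$ and $E_j=\theta_i^{-1}(f_{ij}+\epsilon f_{ij}a_{ij})E_i$, such that $\eta$ is the class of the cocycle $(\{(W_i,-\Lambda_i)\},\{(a_{ij},p_{ij})\})$, where $(W_i,-\Lambda_i)$ is read in the chart $i$ and $(a_{ij},p_{ij})$ in the chart $j$. Then a section $s\in\mathbb{H}^0(X,\Lambda_0,L^\bullet,\nabla)$ is the restriction to $X$ of a global section $\tilde s$ of $\mathcal{L}$ with $\nabla_{\mathcal{L}}\tilde s=0$, i.e. of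 an element of $\mathbb{H}^0(\mathcal{X},\Lambda,\mathcal{L}^\bullet,\nabla_{\mathcal{L}})$, if and only if $M_1(\eta)(s)=0$ in $\mathbb{H}^1(X,\Lambda_0,L^\bullet,\nabla)$. -/

import Mathlib

open CategoryTheory AlgebraicGeometry

universe u v

noncomputable section

namespace PoissonDeformation

/-! ### Sections, restriction, constants -/

/-- Functions on `V`. -/
abbrev Fn (X : Scheme.{u}) (V : X.Opens) : Type u := Γ(X, V)

/-- Sections of the `𝒪_X`-module `M` over `V`. -/
abbrev Sec {X : Scheme.{u}} (M : X.Modules) (V : X.Opens) : Type u := Γ(M, V)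

/-- Restriction of functions. -/
def rs {X : Scheme.{u}} {V W : X.Opens} (h : V ≤ W) : Fn X W →+* Fn X V :=
  (X.presheaf.map (homOfLE h).op).hom

/-- Restriction of sections of a module. -/
def rm {X : Scheme.{u}} (M : X.Modules) {V W : X.Opens} (h : V ≤ W) : Sec M W →+ Sec M V :=
  (M.presheaf.map (homOfLE h).op).hom

/-- The constants: the structure map `R → Γ(V, 𝒪_X)` of a scheme over `Spec R`. -/
def cst {R : Type u} [CommRing R] {X : Scheme.{u}} (f : X ⟶ Spec (.of R)) (V : X.Opens) :
    R →+* Fn X V :=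
  ((f.appLE ⊤ V le_top).hom).comp (Scheme.ΓSpecIso (.of R)).inv.hom

theorem rm_smul {X : Scheme.{u}} (M : X.Modules) {V W : X.Opens} (h : V ≤ W) (a : Fn X W)
    (s : Sec M W) : rm M h (a • s) = rs h a • rm M h s :=
  Scheme.Modules.map_smul M _ a s

theorem rm_rm {X : Scheme.{u}} (M : X.Modules) {V W Y : X.Opens} (h : V ≤ W) (h' : W ≤ Y)
    (s : Sec M Y) : rm M h (rm M h' s) = rm M (h.trans h') s := by
  simp only [rm, ← AddCommGrpCat.comp_apply, ← Functor.map_comp]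
  rfl

/-! ### Projective schemes -/

attribute [local instance] MvPolynomial.gradedAlgebra in
/-- `X` is projective over the field `k`: it admits a closed `k`-immersion into some `ℙⁿ_k`. -/
def IsProjectiveOver (k : Type u) [Field k] {X : Scheme.{u}} (f : X ⟶ Spec (.of k)) : Prop :=
  ∃ (n : ℕ) (j : X ⟶ Proj (MvPolynomial.homogeneousSubmodule (Fin (n + 1)) k)),
    IsClosedImmersion j ∧
      j ≫ Proj.toSpecZero (MvPolynomial.homogeneousSubmodule (Fin (n + 1)) k) ≫
        Spec.map (CommRingCat.ofHom
          (algebraMap k (MvPolynomial.homogeneousSubmodule (Fin (n + 1)) k 0))) = f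

/-! ### Poisson structures, flat Poisson connections, invertible sheaves -/

/-- A Poisson structure on the scheme `X` over `Spec R`: the structure sheaf is a sheaf of
Poisson `R`-algebras. -/
structure PoissonStructure {R : Type u} [CommRing R] {X : Scheme.{u}}
    (f : X ⟶ Spec (.of R)) where
  /-- the bracket `{a, b}` -/
  br : ∀ V : X.Opens, Fn X V → Fn X V → Fn X V
  add_left : ∀ V a b c, br V (a + b) c = br V a c + br V b c
  const_left : ∀ V (r : R) a b, br V (cst f V r * a) b = cst f V r * br V a b
  skew : ∀ V a b, br V a b = - br V b a
  leibniz : ∀ V a b c, br V (a * b) c = a * br V b c + b * br V a c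
  jacobi : ∀ V a b c, br V a (br V b c) + br V b (br V c a) + br V c (br V a b) = 0
  res : ∀ (V W : X.Opens) (h : V ≤ W) a b, rs h (br W a b) = br V (rs h a) (rs h b)

/-- A flat Poisson connection over `R` on an `𝒪_X`-module, i.e. the structure of a Poisson
`𝒪_X`-module. In terms of `∇ : M → Der(𝒪_X, M)`, `∇(s)(a) = {a, s}`. -/
structure FlatPoissonConnection {R : Type u} [CommRing R] {X : Scheme.{u}}
    {f : X ⟶ Spec (.of R)} (P : PoissonStructure f) (M : X.Modules) where
  /-- the bracket `{a, s}` -/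
  br : ∀ V : X.Opens, Fn X V → Sec M V → Sec M V
  add_left : ∀ V a b s, br V (a + b) s = br V a s + br V b s
  add_right : ∀ V a s t, br V a (s + t) = br V a s + br V a t
  const_left : ∀ V (r : R) a s, br V (cst f V r * a) s = cst f V r • br V a s
  const_right : ∀ V (r : R) a s, br V a (cst f V r • s) = cst f V r • br V a s
  leibniz_left : ∀ V a b s, br V (a * b) s = a • br V b s + b • br V a s
  leibniz_right : ∀ V a b s, br V a (b • s) = P.br V a b • s + b • br V a s
  flat : ∀ V a b s, br V a (br V b s) = br V (P.br V a b) s + br V b (br V a s)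
  res : ∀ (V W : X.Opens) (h : V ≤ W) a s, rm M h (br W a s) = br V (rs h a) (rm M h s)

/-- `e` is a frame of `M` over `U`: `a ↦ a • e` is an isomorphism `𝒪_U ≅ M|_U`. -/
def IsFrame {X : Scheme.{u}} (M : X.Modules) {U : X.Opens} (e : Sec M U) : Prop :=
  ∀ (V : X.Opens) (h : V ≤ U), Function.Bijective fun a : Fn X V => a • rm M h e

/-- Invertible sheaves: locally free of rank one. -/
def IsInvertibleSheaf {X : Scheme.{u}} (M : X.Modules) : Prop :=
  ∀ x : X, ∃ (U : X.Opens) (_ : x ∈ U) (e : Sec M U), IsFrame M e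

/-- `ℍ⁰(X, Λ, M^•, ∇)`: the global sections `s` of `M` with `∇ s = 0`. -/
def H0 {R : Type u} [CommRing R] {X : Scheme.{u}} {f : X ⟶ Spec (.of R)}
    {P : PoissonStructure f} {M : X.Modules} (D : FlatPoissonConnection P M) :
    AddSubgroup (Sec M ⊤) where
  carrier := {s | ∀ (V : X.Opens) (a : Fn X V), D.br V a (rm M le_top s) = 0}
  zero_mem' V a := by
    have h := D.add_right V a 0 0
    rw [add_zero] at h
    rw [map_zero]
    exact left_eq_add.mp h
  add_mem' {s t} hs ht V a := by
    rw [map_add, D.add_right, hs V a, ht V a, add_zero]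
  neg_mem' {s} hs V a := by
    have h0 := D.add_right V a 0 0
    rw [add_zero] at h0
    have h := D.add_right V a (rm M le_top s) (-(rm M le_top s))
    rw [add_neg_cancel, left_eq_add.mp h0, hs V a, zero_add] at h
    rw [map_neg]
    exact h.symm

/-! ### Schouten brackets in low degrees

A `p`-vector on an algebra is regarded as an alternating `p`-derivation. These are the values of
the Schouten bracket that occur in degrees `≤ 2` of the complexes below; `[P, a] = P(a, -)` for
a function `a` is written out directly. -/

/-- `[T, b]` for vector fields `T`, `b`. -/
def sch11 {A : Type u} [CommRing A] (T b : A → A) (x : A) : A := T (b x) - b (T x)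

/-- `[P, b]` for a bivector `P` and a vector field `b`. -/
def sch21 {A : Type u} [CommRing A] (P : A → A → A) (b : A → A) (x y : A) : A :=
  P (b x) y - P (b y) x - b (P x y)

/-- `[T, b]` for a vector field `T` and a bivector `b`. -/
def sch12 {A : Type u} [CommRing A] (T : A → A) (b : A → A → A) (x y : A) : A :=
  T (b x y) - (b (T x) y - b (T y) x)

/-- `[P, b]` for bivectors `P`, `b`. -/
def sch22 {A : Type u} [CommRing A] (P b : A → A → A) (x y z : A) : A :=
  (P (b x y) z - P (b x z) y + P (b y z) x) + (b (P x y) z - b (P x z) y + b (P y z) x)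

/-- `D` is an `R`-derivation of `Γ(V, 𝒪_X)` with values in the `Γ(V, 𝒪_X)`-module `N`. -/
structure IsDer {R : Type u} [CommRing R] {X : Scheme.{u}} (f : X ⟶ Spec (.of R))
    {V : X.Opens} {N : Type u} [AddCommGroup N] [Module (Fn X V) N] (D : Fn X V → N) : Prop where
  add : ∀ a b, D (a + b) = D a + D b
  const : ∀ (r : R) a, D (cst f V r * a) = cst f V r • D a
  leibniz : ∀ a b, D (a * b) = a • D b + b • D a

/-- `B` is a skew-symmetric `R`-biderivation of `Γ(V, 𝒪_X)`. -/
structure IsBiDer {R : Type u} [CommRing R] {X : Scheme.{u}} (f : X ⟶ Spec (.of R))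
    {V : X.Opens} (B : Fn X V → Fn X V → Fn X V) : Prop where
  der : ∀ b, IsDer f fun a => B a b
  skew : ∀ a b, B a b = - B b a

section closure

variable {R : Type u} [CommRing R] {X : Scheme.{u}} {f : X ⟶ Spec (.of R)} {V : X.Opens}

theorem IsDer.zero {N : Type u} [AddCommGroup N] [Module (Fn X V) N] :
    IsDer f (0 : Fn X V → N) :=
  ⟨by simp, by simp, by simp⟩

theorem IsDer.plus {N : Type u} [AddCommGroup N] [Module (Fn X V) N] {D E : Fn X V → N}
    (hD : IsDer f D) (hE : IsDer f E) : IsDer f (D + E) :=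
  ⟨fun a b => by simp only [Pi.add_apply, hD.add, hE.add]; abel,
    fun r a => by simp only [Pi.add_apply, hD.const, hE.const, smul_add],
    fun a b => by simp only [Pi.add_apply, hD.leibniz, hE.leibniz, smul_add]; abel⟩

theorem IsDer.neg {N : Type u} [AddCommGroup N] [Module (Fn X V) N] {D : Fn X V → N}
    (hD : IsDer f D) : IsDer f (-D) :=
  ⟨fun a b => by simp only [Pi.neg_apply, hD.add]; abel,
    fun r a => by simp only [Pi.neg_apply, hD.const, smul_neg],
    fun a b => by simp only [Pi.neg_apply, hD.leibniz, smul_neg]; abel⟩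

theorem IsBiDer.zero : IsBiDer f (0 : Fn X V → Fn X V → Fn X V) :=
  ⟨fun _ => IsDer.zero, by simp⟩

theorem IsBiDer.plus {B C : Fn X V → Fn X V → Fn X V} (hB : IsBiDer f B) (hC : IsBiDer f C) :
    IsBiDer f (B + C) :=
  ⟨fun b => (hB.der b).plus (hC.der b), fun a b => by
    simp only [Pi.add_apply]; rw [hB.skew a b, hC.skew a b]; abel⟩

theorem IsBiDer.neg {B : Fn X V → Fn X V → Fn X V} (hB : IsBiDer f B) : IsBiDer f (-B) :=
  ⟨fun b => (hB.der b).neg, fun a b => by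
    simp only [Pi.neg_apply]; rw [hB.skew a b]⟩

end closure

/-! ### Affine coverings that trivialise `L` -/

/-- An affine open covering `{U i}` of `X` with a frame `e i` of `L` over each `U i`. -/
structure FramedCover {X : Scheme.{u}} (L : X.Modules) (ι : Type v) where
  U : ι → X.Opens
  affine : ∀ i, IsAffineOpen (U i)
  cover : ⨆ i, U i = ⊤
  e : ∀ i, Sec L (U i)
  frame : ∀ i, IsFrame L (e i)

namespace FramedCover

variable {X : Scheme.{u}} {L : X.Modules} {ι : Type v} (C : FramedCover L ι)

/-- The restriction of the frame `e i` to `V ⊆ U i`. -/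
def eAt (i : ι) (V : X.Opens) (h : V ≤ C.U i) : Sec L V := rm L h (C.e i)

/-- The coordinate of a section of `L` over `V ⊆ U i` in the frame `e i`: `s = (coord s) • e i`. -/
def coord (i : ι) (V : X.Opens) (h : V ≤ C.U i) (s : Sec L V) : Fn X V :=
  (Equiv.ofBijective _ (C.frame i V h)).symm s

/-- The transition function `f_ij` on `V ⊆ U i ∩ U j`: the coordinates of a section `s` satisfy
`s_i = f_ij s_j`, i.e. `e_j = f_ij e_i`. -/
def trans (i j : ι) (V : X.Opens) (hi : V ≤ C.U i) (hj : V ≤ C.U j) : Fn X V :=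
  C.coord i V hi (C.eAt j V hj)

theorem coord_smul (i : ι) (V : X.Opens) (h : V ≤ C.U i) (s : Sec L V) :
    C.coord i V h s • C.eAt i V h = s :=
  (Equiv.ofBijective _ (C.frame i V h)).apply_symm_apply s

theorem smul_inj (i : ι) (V : X.Opens) (h : V ≤ C.U i) {a b : Fn X V}
    (hab : a • C.eAt i V h = b • C.eAt i V h) : a = b :=
  (C.frame i V h).1 hab

theorem coord_eq (i : ι) (V : X.Opens) (h : V ≤ C.U i) {s : Sec L V} {a : Fn X V}
    (ha : a • C.eAt i V h = s) : C.coord i V h s = a :=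
  C.smul_inj i V h ((C.coord_smul i V h s).trans ha.symm)

theorem rm_eAt (i : ι) {V W : X.Opens} (h : V ≤ W) (hW : W ≤ C.U i) :
    rm L h (C.eAt i W hW) = C.eAt i V (h.trans hW) :=
  rm_rm L h hW _

theorem rs_coord (i : ι) {V W : X.Opens} (h : V ≤ W) (hW : W ≤ C.U i) (s : Sec L W) :
    rs h (C.coord i W hW s) = C.coord i V (h.trans hW) (rm L h s) := by
  symm
  apply C.coord_eq
  rw [← C.rm_eAt i h hW, ← rm_smul, C.coord_smul]

theorem trans_smul (i j : ι) (V : X.Opens) (hi : V ≤ C.U i) (hj : V ≤ C.U j) :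
    C.trans i j V hi hj • C.eAt i V hi = C.eAt j V hj :=
  C.coord_smul i V hi _

/-- `f_ji` is the inverse of `f_ij`. -/
theorem trans_mul (i j : ι) (V : X.Opens) (hi : V ≤ C.U i) (hj : V ≤ C.U j) :
    C.trans j i V hj hi * C.trans i j V hi hj = 1 := by
  apply C.smul_inj i V hi
  rw [mul_smul, C.trans_smul, C.trans_smul, one_smul]

theorem coord_trans (i j : ι) (V : X.Opens) (hi : V ≤ C.U i) (hj : V ≤ C.U j) (s : Sec L V) :
    C.coord i V hi s = C.trans i j V hi hj * C.coord j V hj s := by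
  apply C.coord_eq
  rw [mul_comm, mul_smul, C.trans_smul, C.coord_smul]

theorem coord_add (i : ι) (V : X.Opens) (h : V ≤ C.U i) (s t : Sec L V) :
    C.coord i V h (s + t) = C.coord i V h s + C.coord i V h t :=
  C.coord_eq i V h (by rw [add_smul, C.coord_smul, C.coord_smul])

end FramedCover

section complexes

variable {R : Type u} [CommRing R] {X : Scheme.{u}} {f : X ⟶ Spec (.of R)}
  {P : PoissonStructure f} {L : X.Modules} (D : FlatPoissonConnection P L)
  {ι : Type v} (C : FramedCover L ι)

/-- The Poisson vector field `T_i` of the connection in the frame `e_i`: `{a, e_i} = T_i(a) e_i`. -/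
def vecT (i : ι) (V : X.Opens) (h : V ≤ C.U i) (a : Fn X V) : Fn X V :=
  C.coord i V h (D.br V a (C.eAt i V h))

/-! ### The complex `𝓔_L^•`

A section of `𝓔_L^p` over `U` is a system `(a_l, b_l)`, where `a_l` is a `p`-vector and `b_l` a
`(p+1)`-vector on `U ∩ U_l`, such that `b_i = b_j` and `a_j - a_i = [b_i, log f_ij]` on
`U ∩ U_i ∩ U_j`. A vector field on `U ∩ U_l` is given by its values on all opens `V ⊆ U ∩ U_l`. -/

/-- Systems of a function and a vector field (not yet subject to any condition). -/
abbrev Fam0 (U : X.Opens) : Type (max u v) :=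
  ∀ (l : ι) (V : {V : X.Opens // V ≤ U ∧ V ≤ C.U l}), Fn X V.1 × (Fn X V.1 → Fn X V.1)

/-- Systems of a vector field and a bivector (not yet subject to any condition). -/
abbrev Fam1 (U : X.Opens) : Type (max u v) :=
  ∀ (l : ι) (V : {V : X.Opens // V ≤ U ∧ V ≤ C.U l}),
    (Fn X V.1 → Fn X V.1) × (Fn X V.1 → Fn X V.1 → Fn X V.1)

variable (f)

/-- The sections of `𝓔_L^0` over `U`. -/
def E0 (U : X.Opens) : AddSubgroup (Fam0 C U) where
  carrier := {x |
    (∀ l V hU hl, IsDer f (x l ⟨V, hU, hl⟩).2) ∧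
    (∀ l V W (h : V ≤ W) hU hl,
      rs h (x l ⟨W, hU, hl⟩).1 = (x l ⟨V, h.trans hU, h.trans hl⟩).1 ∧
      ∀ a, rs h ((x l ⟨W, hU, hl⟩).2 a) = (x l ⟨V, h.trans hU, h.trans hl⟩).2 (rs h a)) ∧
    (∀ i j V hU hi hj,
      (x i ⟨V, hU, hi⟩).2 = (x j ⟨V, hU, hj⟩).2 ∧
      (x j ⟨V, hU, hj⟩).1 - (x i ⟨V, hU, hi⟩).1 =
        C.trans j i V hj hi * (x i ⟨V, hU, hi⟩).2 (C.trans i j V hi hj))}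
  zero_mem' := by
    refine ⟨fun _ _ _ _ => IsDer.zero, ?_, ?_⟩ <;> simp
  add_mem' := by
    rintro x y ⟨hx, hx', hx''⟩ ⟨hy, hy', hy''⟩
    refine ⟨fun l V hU hl => (hx l V hU hl).plus (hy l V hU hl), fun l V W h hU hl => ⟨?_, fun a => ?_⟩,
      fun i j V hU hi hj => ⟨?_, ?_⟩⟩
    · simp [(hx' l V W h hU hl).1, (hy' l V W h hU hl).1]
    · simp [(hx' l V W h hU hl).2, (hy' l V W h hU hl).2]
    · simp [(hx'' i j V hU hi hj).1, (hy'' i j V hU hi hj).1]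
    · have h1 := (hx'' i j V hU hi hj).2
      have h2 := (hy'' i j V hU hi hj).2
      simp only [Pi.add_apply, Prod.fst_add, Prod.snd_add]
      linear_combination h1 + h2
  neg_mem' := by
    rintro x ⟨hx, hx', hx''⟩
    refine ⟨fun l V hU hl => (hx l V hU hl).neg, fun l V W h hU hl => ⟨?_, fun a => ?_⟩,
      fun i j V hU hi hj => ⟨?_, ?_⟩⟩
    · simp [(hx' l V W h hU hl).1]
    · simp [(hx' l V W h hU hl).2]
    · simp [(hx'' i j V hU hi hj).1]
    · have h1 := (hx'' i j V hU hi hj).2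
      simp only [Pi.neg_apply, Prod.fst_neg, Prod.snd_neg]
      linear_combination -h1

/-- The sections of `𝓔_L^1` over `U`. -/
def E1 (U : X.Opens) : AddSubgroup (Fam1 C U) where
  carrier := {x |
    (∀ l V hU hl, IsDer f (x l ⟨V, hU, hl⟩).1 ∧ IsBiDer f (x l ⟨V, hU, hl⟩).2) ∧
    (∀ l V W (h : V ≤ W) hU hl,
      (∀ a, rs h ((x l ⟨W, hU, hl⟩).1 a) = (x l ⟨V, h.trans hU, h.trans hl⟩).1 (rs h a)) ∧
      ∀ a b, rs h ((x l ⟨W, hU, hl⟩).2 a b) =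
        (x l ⟨V, h.trans hU, h.trans hl⟩).2 (rs h a) (rs h b)) ∧
    (∀ i j V hU hi hj,
      (x i ⟨V, hU, hi⟩).2 = (x j ⟨V, hU, hj⟩).2 ∧
      ∀ a, (x j ⟨V, hU, hj⟩).1 a - (x i ⟨V, hU, hi⟩).1 a =
        C.trans j i V hj hi * (x i ⟨V, hU, hi⟩).2 (C.trans i j V hi hj) a)}
  zero_mem' := by
    refine ⟨fun _ _ _ _ => ⟨IsDer.zero, IsBiDer.zero⟩, ?_, ?_⟩ <;> simp
  add_mem' := by
    rintro x y ⟨hx, hx', hx''⟩ ⟨hy, hy', hy''⟩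
    refine ⟨fun l V hU hl => ⟨(hx l V hU hl).1.plus (hy l V hU hl).1,
        (hx l V hU hl).2.plus (hy l V hU hl).2⟩,
      fun l V W h hU hl => ⟨fun a => ?_, fun a b => ?_⟩,
      fun i j V hU hi hj => ⟨?_, fun a => ?_⟩⟩
    · simp [(hx' l V W h hU hl).1, (hy' l V W h hU hl).1]
    · simp [(hx' l V W h hU hl).2, (hy' l V W h hU hl).2]
    · simp [(hx'' i j V hU hi hj).1, (hy'' i j V hU hi hj).1]
    · have h1 := (hx'' i j V hU hi hj).2 a
      have h2 := (hy'' i j V hU hi hj).2 a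
      simp only [Pi.add_apply, Prod.fst_add, Prod.snd_add]
      linear_combination h1 + h2
  neg_mem' := by
    rintro x ⟨hx, hx', hx''⟩
    refine ⟨fun l V hU hl => ⟨(hx l V hU hl).1.neg, (hx l V hU hl).2.neg⟩,
      fun l V W h hU hl => ⟨fun a => ?_, fun a b => ?_⟩,
      fun i j V hU hi hj => ⟨?_, fun a => ?_⟩⟩
    · simp [(hx' l V W h hU hl).1]
    · simp [(hx' l V W h hU hl).2]
    · simp [(hx'' i j V hU hi hj).1]
    · have h1 := (hx'' i j V hU hi hj).2 a
      simp only [Pi.neg_apply, Prod.fst_neg, Prod.snd_neg]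
      linear_combination -h1

variable {f}

theorem vecT_smul (l : ι) (V : X.Opens) (hl : V ≤ C.U l) (a : Fn X V) :
    D.br V a (C.eAt l V hl) = vecT D C l V hl a • C.eAt l V hl :=
  (C.coord_smul l V hl _).symm

theorem vecT_add (l : ι) (V : X.Opens) (hl : V ≤ C.U l) (a b : Fn X V) :
    vecT D C l V hl (a + b) = vecT D C l V hl a + vecT D C l V hl b := by
  rw [vecT, D.add_left, C.coord_add]; rfl

/-- The differential `𝓔_L^0 → 𝓔_L^1` in the chart `l`:
`(a, b) ↦ ([Λ, a] - [T_l, b], [Λ, b])`. -/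
def dE0 (l : ι) (V : X.Opens) (hl : V ≤ C.U l) :
    (Fn X V × (Fn X V → Fn X V)) →+ (Fn X V → Fn X V) × (Fn X V → Fn X V → Fn X V) :=
  AddMonoidHom.mk'
    (fun x => (fun y => P.br V x.1 y - sch11 (vecT D C l V hl) x.2 y, sch21 (P.br V) x.2))
    (by
      intro x x'
      ext y z
      · simp only [sch11, Prod.fst_add, Prod.snd_add, Pi.add_apply, P.add_left, vecT_add]; ring
      · simp only [sch21, Prod.snd_add, Pi.add_apply, P.add_left]; ring)

/-- The differential `𝓔_L^1 → 𝓔_L^2` in the chart `l`: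
`(a, b) ↦ ([Λ, a] + [T_l, b], [Λ, b])`. -/
def dE1 (l : ι) (V : X.Opens) (hl : V ≤ C.U l) :
    (Fn X V → Fn X V) × (Fn X V → Fn X V → Fn X V) →+
      (Fn X V → Fn X V → Fn X V) × (Fn X V → Fn X V → Fn X V → Fn X V) :=
  AddMonoidHom.mk'
    (fun x => (fun y z => sch21 (P.br V) x.1 y z + sch12 (vecT D C l V hl) x.2 y z,
      sch22 (P.br V) x.2))
    (by
      intro x x'
      ext y z w
      · simp only [sch12, sch21, Prod.fst_add, Prod.snd_add, Pi.add_apply, P.add_left, vecT_add]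
        ring
      · simp only [sch22, Prod.snd_add, Pi.add_apply, P.add_left]; ring)

/-! ### The Čech hypercohomology group `ℍ¹(X, Λ, 𝓔_L^•)`

Total complex `C⁰(𝓔⁰) → C⁰(𝓔¹) ⊕ C¹(𝓔⁰) → C⁰(𝓔²) ⊕ C¹(𝓔¹) ⊕ C²(𝓔⁰)` of the covering, with
`z ↦ (d z, -δ z)` and `(x, y) ↦ (d x, δ x + d y, δ y)`. -/

variable (f) in
/-- `C⁰(𝓤, 𝓔_L^1) ⊕ C¹(𝓤, 𝓔_L^0)`. -/
abbrev CochE : Type (max u v) :=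
  (∀ i, E1 f C (C.U i)) × (∀ i j, E0 f C (C.U i ⊓ C.U j))

/-- The 1-cocycles. -/
def Z1E : AddSubgroup (CochE f C) where
  carrier := {c |
    (∀ i l V (h : V ≤ C.U i) (hl : V ≤ C.U l), dE1 D C l V hl ((c.1 i).1 l ⟨V, h, hl⟩) = 0) ∧
    (∀ i j l V (hi : V ≤ C.U i) (hj : V ≤ C.U j) (hl : V ≤ C.U l),
      ((c.1 j).1 l ⟨V, hj, hl⟩ - (c.1 i).1 l ⟨V, hi, hl⟩) +
        dE0 D C l V hl ((c.2 i j).1 l ⟨V, le_inf hi hj, hl⟩) = 0) ∧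
    (∀ i j k l V (hi : V ≤ C.U i) (hj : V ≤ C.U j) (hk : V ≤ C.U k) (hl : V ≤ C.U l),
      (c.2 j k).1 l ⟨V, le_inf hj hk, hl⟩ - (c.2 i k).1 l ⟨V, le_inf hi hk, hl⟩ +
        (c.2 i j).1 l ⟨V, le_inf hi hj, hl⟩ = 0)}
  zero_mem' := by
    refine ⟨fun i l V h hl => map_zero _, fun i j l V hi hj hl => ?_,
      fun i j k l V hi hj hk hl => ?_⟩
    · exact (congrArg₂ (· + ·) (sub_self _) (map_zero _)).trans (add_zero _)
    · exact (congrArg₂ (· + ·) (sub_self _) rfl).trans (add_zero _)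
  add_mem' := by
    rintro x y ⟨hx, hx', hx''⟩ ⟨hy, hy', hy''⟩
    refine ⟨fun i l V h hl => ?_, fun i j l V hi hj hl => ?_, fun i j k l V hi hj hk hl => ?_⟩
    · have h1 := hx i l V h hl
      have h2 := hy i l V h hl
      simp only [Prod.fst_add, Pi.add_apply, AddSubgroup.coe_add, map_add, h1, h2, add_zero]
    · have h1 := hx' i j l V hi hj hl
      have h2 := hy' i j l V hi hj hl
      simp only [Prod.fst_add, Prod.snd_add, Pi.add_apply, AddSubgroup.coe_add, map_add]
      rw [← add_zero (0 : (Fn X V → Fn X V) × (Fn X V → Fn X V → Fn X V))]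
      nth_rewrite 1 [← h1]
      rw [← h2]
      abel
    · have h1 := hx'' i j k l V hi hj hk hl
      have h2 := hy'' i j k l V hi hj hk hl
      simp only [Prod.snd_add, Pi.add_apply, AddSubgroup.coe_add]
      rw [← add_zero (0 : Fn X V × (Fn X V → Fn X V))]
      nth_rewrite 1 [← h1]
      rw [← h2]
      abel
  neg_mem' := by
    rintro x ⟨hx, hx', hx''⟩
    refine ⟨fun i l V h hl => ?_, fun i j l V hi hj hl => ?_, fun i j k l V hi hj hk hl => ?_⟩
    · have h1 := hx i l V h hl
      simp only [Prod.fst_neg, Pi.neg_apply, AddSubgroup.coe_neg, map_neg, h1, neg_zero]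
    · have h1 := hx' i j l V hi hj hl
      simp only [Prod.fst_neg, Prod.snd_neg, Pi.neg_apply, AddSubgroup.coe_neg, map_neg]
      rw [← neg_zero, ← h1]
      abel
    · have h1 := hx'' i j k l V hi hj hk hl
      simp only [Prod.snd_neg, Pi.neg_apply, AddSubgroup.coe_neg]
      rw [← neg_zero, ← h1]
      abel

/-- The 1-coboundaries. -/
def B1E : AddSubgroup (CochE f C) where
  carrier := {c | ∃ z : ∀ i, E0 f C (C.U i),
    (∀ i l V (h : V ≤ C.U i) (hl : V ≤ C.U l),
      (c.1 i).1 l ⟨V, h, hl⟩ = dE0 D C l V hl ((z i).1 l ⟨V, h, hl⟩)) ∧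
    (∀ i j l V (hi : V ≤ C.U i) (hj : V ≤ C.U j) (hl : V ≤ C.U l),
      (c.2 i j).1 l ⟨V, le_inf hi hj, hl⟩ =
        -((z j).1 l ⟨V, hj, hl⟩ - (z i).1 l ⟨V, hi, hl⟩))}
  zero_mem' :=
    ⟨0, fun i l V h hl => (map_zero _).symm, fun i j l V hi hj hl =>
      ((congrArg Neg.neg (sub_self _)).trans neg_zero).symm⟩
  add_mem' := by
    rintro x y ⟨z, hx, hx'⟩ ⟨w, hy, hy'⟩
    refine ⟨z + w, fun i l V h hl => ?_, fun i j l V hi hj hl => ?_⟩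
    · have h1 := hx i l V h hl
      have h2 := hy i l V h hl
      simp only [Prod.fst_add, Pi.add_apply, AddSubgroup.coe_add, map_add, h1, h2]
    · have h1 := hx' i j l V hi hj hl
      have h2 := hy' i j l V hi hj hl
      simp only [Prod.snd_add, Pi.add_apply, AddSubgroup.coe_add, h1, h2]
      abel
  neg_mem' := by
    rintro x ⟨z, hx, hx'⟩
    refine ⟨-z, fun i l V h hl => ?_, fun i j l V hi hj hl => ?_⟩
    · have h1 := hx i l V h hl
      simp only [Prod.fst_neg, Pi.neg_apply, AddSubgroup.coe_neg, map_neg, h1]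
    · have h1 := hx' i j l V hi hj hl
      simp only [Prod.snd_neg, Pi.neg_apply, AddSubgroup.coe_neg, h1]
      abel

/-- `ℍ¹(X, Λ, 𝓔_L^•)`. -/
abbrev H1E : Type (max u v) := Z1E D C ⧸ (B1E D C).addSubgroupOf (Z1E D C)

/-! ### The complex `L^•` and `ℍ¹(X, Λ, L^•, ∇)`

`L^0 = L`, `L^1 = Der(𝒪_X, L) = T_X ⊗ L` and `L^2 = Der²(𝒪_X, L) = ∧²T_X ⊗ L`, with
`v₀(s)(a) = {a, s}` and `v₁(δ)(a, b) = {a, δ b} - {b, δ a} - δ {a, b}`. The differentials of the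
total Čech complex are `z ↦ (v₀ z, δ z)` and `(x, y) ↦ (v₁ x, -δ x + v₀ y, -δ y)`. -/

variable (f L) in
/-- The sections of `L^1 = Der(𝒪_X, L)` over `U`. -/
def L1 (U : X.Opens) :
    AddSubgroup (∀ V : {V : X.Opens // V ≤ U}, Fn X V.1 → Sec L V.1) where
  carrier := {x | (∀ V, IsDer f (x V)) ∧
    ∀ V W (h : V ≤ W) (hW : W ≤ U) a,
      rm L h (x ⟨W, hW⟩ a) = x ⟨V, h.trans hW⟩ (rs h a)}
  zero_mem' := ⟨fun _ => IsDer.zero, by simp⟩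
  add_mem' := by
    rintro x y ⟨hx, hx'⟩ ⟨hy, hy'⟩
    exact ⟨fun V => (hx V).plus (hy V), fun V W h hW a => by simp [hx' V W h hW, hy' V W h hW]⟩
  neg_mem' := by
    rintro x ⟨hx, hx'⟩
    exact ⟨fun V => (hx V).neg, fun V W h hW a => by simp [hx' V W h hW]⟩

/-- `v₀ = ∇ : L → Der(𝒪_X, L)` on sections over `U`. -/
def v0 (U : X.Opens) : Sec L U →+ L1 f L U :=
  AddMonoidHom.mk'
    (fun s => ⟨fun V a => D.br V.1 a (rm L V.2 s),
      fun V => ⟨fun a b => D.add_left _ a b _, fun r a => D.const_left _ r a _,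
        fun a b => D.leibniz_left _ a b _⟩,
      fun V W h hW a => by rw [D.res _ _ h, rm_rm]⟩)
    (fun s t => by
      ext V a
      exact (congrArg _ (map_add _ s t)).trans (D.add_right _ a _ _))

/-- `v₁ : Der(𝒪_X, L) → Der²(𝒪_X, L)` on `V`. -/
def v1 (V : X.Opens) (x : Fn X V → Sec L V) (a b : Fn X V) : Sec L V :=
  D.br V a (x b) - D.br V b (x a) - x (P.br V a b)

variable (f) in
/-- `C⁰(𝓤, L^1) ⊕ C¹(𝓤, L^0)`. -/
abbrev CochL : Type (max u v) := (∀ i, L1 f L (C.U i)) × (∀ i j, Sec L (C.U i ⊓ C.U j))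

theorem br_zero (V : X.Opens) (a : Fn X V) : D.br V a 0 = 0 := by
  have h := D.add_right V a 0 0
  rw [add_zero] at h
  exact left_eq_add.mp h

theorem br_neg (V : X.Opens) (a : Fn X V) (s : Sec L V) : D.br V a (-s) = -D.br V a s := by
  have h := D.add_right V a s (-s)
  rw [add_neg_cancel, br_zero] at h
  exact (neg_eq_of_add_eq_zero_right h.symm).symm

/-- The 1-cocycles. -/
def Z1L : AddSubgroup (CochL f C) where
  carrier := {c |
    (∀ i V (h : V ≤ C.U i) a b, v1 D V ((c.1 i).1 ⟨V, h⟩) a b = 0) ∧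
    (∀ i j V (hi : V ≤ C.U i) (hj : V ≤ C.U j) a,
      -((c.1 j).1 ⟨V, hj⟩ a - (c.1 i).1 ⟨V, hi⟩ a) +
        (v0 D _ (c.2 i j)).1 ⟨V, le_inf hi hj⟩ a = 0) ∧
    (∀ i j k V (hi : V ≤ C.U i) (hj : V ≤ C.U j) (hk : V ≤ C.U k),
      -(rm L (le_inf hj hk) (c.2 j k) - rm L (le_inf hi hk) (c.2 i k) +
        rm L (le_inf hi hj) (c.2 i j)) = 0)}
  zero_mem' := by
    refine ⟨fun i V h a b => ?_, fun i j V hi hj a => ?_, fun i j k V hi hj hk => ?_⟩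
    · simp [v1, br_zero]
    · simp
    · simp
  add_mem' := by
    rintro x y ⟨hx, hx', hx''⟩ ⟨hy, hy', hy''⟩
    refine ⟨fun i V h a b => ?_, fun i j V hi hj a => ?_, fun i j k V hi hj hk => ?_⟩
    · have h1 := hx i V h a b
      have h2 := hy i V h a b
      simp only [v1, Prod.fst_add, Pi.add_apply, AddSubgroup.coe_add, D.add_right] at h1 h2 ⊢
      rw [← add_zero (0 : Sec L V)]
      nth_rewrite 1 [← h1]
      rw [← h2]
      abel
    · have h1 := hx' i j V hi hj a
      have h2 := hy' i j V hi hj a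
      simp only [Prod.fst_add, Prod.snd_add, Pi.add_apply, AddSubgroup.coe_add, map_add]
      rw [← add_zero (0 : Sec L V)]
      nth_rewrite 1 [← h1]
      rw [← h2]
      abel
    · have h1 := hx'' i j k V hi hj hk
      have h2 := hy'' i j k V hi hj hk
      simp only [Prod.snd_add, Pi.add_apply, map_add]
      rw [← add_zero (0 : Sec L V)]
      nth_rewrite 1 [← h1]
      rw [← h2]
      abel
  neg_mem' := by
    rintro x ⟨hx, hx', hx''⟩
    refine ⟨fun i V h a b => ?_, fun i j V hi hj a => ?_, fun i j k V hi hj hk => ?_⟩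
    · have h1 := hx i V h a b
      simp only [v1, Prod.fst_neg, Pi.neg_apply, AddSubgroup.coe_neg, br_neg] at h1 ⊢
      rw [← neg_zero, ← h1]
      abel
    · have h1 := hx' i j V hi hj a
      simp only [Prod.fst_neg, Prod.snd_neg, Pi.neg_apply, AddSubgroup.coe_neg, map_neg]
      rw [← neg_zero, ← h1]
      abel
    · have h1 := hx'' i j k V hi hj hk
      simp only [Prod.snd_neg, Pi.neg_apply, map_neg]
      rw [← neg_zero, ← h1]
      abel

/-- The 1-coboundaries. -/
def B1L : AddSubgroup (CochL f C) where
  carrier := {c | ∃ z : ∀ i, Sec L (C.U i), (∀ i, c.1 i = v0 D _ (z i)) ∧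
    ∀ i j, c.2 i j = rm L inf_le_right (z j) - rm L inf_le_left (z i)}
  zero_mem' := ⟨0, fun i => (map_zero _).symm, fun i j => by simp⟩
  add_mem' := by
    rintro x y ⟨z, hx, hx'⟩ ⟨w, hy, hy'⟩
    refine ⟨z + w, fun i => ?_, fun i j => ?_⟩
    · simp only [Prod.fst_add, Pi.add_apply, map_add, hx, hy]
    · simp only [Prod.snd_add, Pi.add_apply, map_add, hx', hy']
      abel
  neg_mem' := by
    rintro x ⟨z, hx, hx'⟩
    refine ⟨-z, fun i => ?_, fun i j => ?_⟩
    · simp only [Prod.fst_neg, Pi.neg_apply, map_neg, hx]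
    · simp only [Prod.snd_neg, Pi.neg_apply, map_neg, hx']
      abel

/-- `ℍ¹(X, Λ, L^•, ∇)`. -/
abbrev H1L : Type (max u v) := Z1L D C ⧸ (B1L D C).addSubgroupOf (Z1L D C)

/-! ### The homomorphism `M_1` -/

/-- `M_0(a, b)(s)` on `V ⊆ U_l`: the section of `L` with coordinate `s_l a + [b, s_l]` in the
frame `e_l`. -/
def M0At (l : ι) (V : X.Opens) (hl : V ≤ C.U l) (x : Fn X V × (Fn X V → Fn X V)) (s : Sec L V) :
    Sec L V :=
  (C.coord l V hl s * x.1 + x.2 (C.coord l V hl s)) • C.eAt l V hl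

/-- `M_1(a, b)(s)` on `V ⊆ U_l`: the section of `T_X ⊗ L` with coordinate `s_l a + [b, s_l]` in
the frame `e_l`. -/
def M1At (l : ι) (V : X.Opens) (hl : V ≤ C.U l)
    (x : (Fn X V → Fn X V) × (Fn X V → Fn X V → Fn X V)) (s : Sec L V) (y : Fn X V) : Sec L V :=
  (C.coord l V hl s * x.1 y + x.2 (C.coord l V hl s) y) • C.eAt l V hl

/-- `M_0` does not depend on the chart. -/
theorem M0At_chart {U : X.Opens} (x : E0 f C U) (i j : ι) (V : X.Opens) (hU : V ≤ U)
    (hi : V ≤ C.U i) (hj : V ≤ C.U j) (s : Sec L V) :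
    M0At C i V hi (x.1 i ⟨V, hU, hi⟩) s = M0At C j V hj (x.1 j ⟨V, hU, hj⟩) s := by
  obtain ⟨h1, h2⟩ := x.2.2.2 i j V hU hi hj
  have hd := (x.2.1 i V hU hi).leibniz
  have h3 := C.trans_mul i j V hi hj
  rw [M0At, M0At, ← C.trans_smul i j V hi hj, smul_smul, C.coord_trans i j V hi hj s, ← h1, hd]
  congr 1
  simp only [smul_eq_mul]
  generalize C.trans i j V hi hj = t at *
  linear_combination (-C.coord j V hj s * t) * h2 - C.coord j V hj s * (x.1 i ⟨V, hU, hi⟩).2 t * h3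

/-- `M_1` does not depend on the chart. -/
theorem M1At_chart {U : X.Opens} (x : E1 f C U) (i j : ι) (V : X.Opens) (hU : V ≤ U)
    (hi : V ≤ C.U i) (hj : V ≤ C.U j) (s : Sec L V) (y : Fn X V) :
    M1At C i V hi (x.1 i ⟨V, hU, hi⟩) s y = M1At C j V hj (x.1 j ⟨V, hU, hj⟩) s y := by
  obtain ⟨h1, h2⟩ := x.2.2.2 i j V hU hi hj
  have hd := ((x.2.1 i V hU hi).2.der y).leibniz
  have h3 := C.trans_mul i j V hi hj
  replace h2 := h2 y
  rw [M1At, M1At, ← C.trans_smul i j V hi hj, smul_smul, C.coord_trans i j V hi hj s, ← h1, hd]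
  congr 1
  simp only [smul_eq_mul]
  generalize C.trans i j V hi hj = t at *
  linear_combination
    (-C.coord j V hj s * t) * h2 - C.coord j V hj s * (x.1 i ⟨V, hU, hi⟩).2 t y * h3

theorem M0At_res {U : X.Opens} (x : E0 f C U) (l : ι) {V W : X.Opens} (h : V ≤ W) (hU : W ≤ U)
    (hl : W ≤ C.U l) (s : Sec L W) :
    rm L h (M0At C l W hl (x.1 l ⟨W, hU, hl⟩) s) =
      M0At C l V (h.trans hl) (x.1 l ⟨V, h.trans hU, h.trans hl⟩) (rm L h s) := by
  obtain ⟨h1, h2⟩ := x.2.2.1 l V W h hU hl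
  rw [M0At, M0At, rm_smul, C.rm_eAt, map_add, map_mul, h1, h2, C.rs_coord]

theorem M1At_res {U : X.Opens} (x : E1 f C U) (l : ι) {V W : X.Opens} (h : V ≤ W) (hU : W ≤ U)
    (hl : W ≤ C.U l) (s : Sec L W) (y : Fn X W) :
    rm L h (M1At C l W hl (x.1 l ⟨W, hU, hl⟩) s y) =
      M1At C l V (h.trans hl) (x.1 l ⟨V, h.trans hU, h.trans hl⟩) (rm L h s) (rs h y) := by
  obtain ⟨h1, h2⟩ := x.2.2.1 l V W h hU hl
  rw [M1At, M1At, rm_smul, C.rm_eAt, map_add, map_mul, h1, h2, C.rs_coord]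

theorem M0At_add_left (l : ι) (V : X.Opens) (hl : V ≤ C.U l) (x y) (s : Sec L V) :
    M0At C l V hl (x + y) s = M0At C l V hl x s + M0At C l V hl y s := by
  simp only [M0At, Prod.fst_add, Prod.snd_add, Pi.add_apply, ← add_smul]
  congr 1
  ring

theorem M1At_add_left (l : ι) (V : X.Opens) (hl : V ≤ C.U l) (x y) (s : Sec L V) (z : Fn X V) :
    M1At C l V hl (x + y) s z = M1At C l V hl x s z + M1At C l V hl y s z := by
  simp only [M1At, Prod.fst_add, Prod.snd_add, Pi.add_apply, ← add_smul]
  congr 1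
  ring

theorem M0At_add_right {l : ι} {V : X.Opens} {hl : V ≤ C.U l} {x : Fn X V × (Fn X V → Fn X V)}
    (hx : IsDer f x.2) (s t : Sec L V) :
    M0At C l V hl x (s + t) = M0At C l V hl x s + M0At C l V hl x t := by
  simp only [M0At, C.coord_add, hx.add, ← add_smul]
  congr 1
  ring

theorem M1At_add_right {l : ι} {V : X.Opens} {hl : V ≤ C.U l}
    {x : (Fn X V → Fn X V) × (Fn X V → Fn X V → Fn X V)}
    (hx : IsBiDer f x.2) (s t : Sec L V) (y : Fn X V) :
    M1At C l V hl x (s + t) y = M1At C l V hl x s y + M1At C l V hl x t y := by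
  simp only [M1At, C.coord_add, (hx.der y).add, ← add_smul]
  congr 1
  ring

theorem M1At_isDer {l : ι} {V : X.Opens} {hl : V ≤ C.U l}
    {x : (Fn X V → Fn X V) × (Fn X V → Fn X V → Fn X V)}
    (hx : IsDer f x.1) (hx' : IsBiDer f x.2) (s : Sec L V) :
    IsDer f (M1At C l V hl x s) where
  add a b := by
    simp only [M1At, hx.add, hx'.skew _ (a + b), (hx'.der _).add, hx'.skew _ a, hx'.skew _ b,
      ← add_smul]
    congr 1
    ring
  const r a := by
    simp only [M1At, hx.const, hx'.skew _ (cst f V r * a), (hx'.der _).const, hx'.skew _ a,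
      smul_smul, smul_eq_mul]
    congr 1
    ring
  leibniz a b := by
    simp only [M1At, hx.leibniz, hx'.skew _ (a * b), (hx'.der _).leibniz, hx'.skew _ a,
      hx'.skew _ b, smul_smul, smul_eq_mul, ← add_smul]
    congr 1
    ring

theorem PoissonStructure.add_right (V : X.Opens) (a b c : Fn X V) :
    P.br V a (b + c) = P.br V a b + P.br V a c := by
  rw [P.skew V a, P.add_left, P.skew V b, P.skew V c]; ring

theorem PoissonStructure.leibniz_right (V : X.Opens) (a b c : Fn X V) :
    P.br V a (b * c) = b * P.br V a c + c * P.br V a b := by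
  rw [P.skew V a, P.leibniz, P.skew V b, P.skew V c]; ring

theorem br_coord (l : ι) (V : X.Opens) (hl : V ≤ C.U l) (a u : Fn X V) :
    D.br V a (u • C.eAt l V hl) = (P.br V a u + u * vecT D C l V hl a) • C.eAt l V hl := by
  rw [D.leibniz_right, vecT_smul, smul_smul, add_smul]

theorem flat_coord (l : ι) (V : X.Opens) (hl : V ≤ C.U l) {s : Sec L V}
    (hs : ∀ a, D.br V a s = 0) (a : Fn X V) :
    P.br V a (C.coord l V hl s) = -(C.coord l V hl s * vecT D C l V hl a) := by
  have h := hs a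
  rw [← C.coord_smul l V hl s, br_coord] at h
  have h2 := C.smul_inj l V hl (h.trans (zero_smul _ _).symm)
  linear_combination h2

/-- `v₀ M_0 = - M_1 d` on a horizontal section. -/
theorem br_M0At (l : ι) (V : X.Opens) (hl : V ≤ C.U l) {s : Sec L V}
    (hs : ∀ a, D.br V a s = 0) {x : Fn X V × (Fn X V → Fn X V)} (hx : IsDer f x.2)
    (y : Fn X V) :
    D.br V y (M0At C l V hl x s) = -M1At C l V hl (dE0 D C l V hl x) s y := by
  have hf := flat_coord D C l V hl hs
  rw [M0At, br_coord, M1At, ← neg_smul]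
  congr 1
  generalize C.coord l V hl s = σ at *
  generalize hT : vecT D C l V hl = T at *
  have e1 := hf y
  have e2 := hf (x.2 y)
  have e3 : x.2 (P.br V y σ) = -(σ * x.2 (T y) + T y * x.2 σ) := by
    rw [e1]
    have h := hx.add (σ * T y) (-(σ * T y))
    have h0 := hx.add 0 0
    rw [add_zero] at h0
    rw [add_neg_cancel, left_eq_add.mp h0, hx.leibniz] at h
    simp only [smul_eq_mul] at h
    linear_combination -h
  have e4 : x.2 (P.br V σ y) = σ * x.2 (T y) + T y * x.2 σ := by
    rw [P.skew V σ y, e1, neg_neg, hx.leibniz]; simp only [smul_eq_mul]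
  simp only [dE0, AddMonoidHom.mk'_apply, hT, sch11, sch21, P.add_right, P.leibniz_right]
  rw [e1, e2, e4, P.skew V x.1 y, P.skew V (x.2 σ) y]
  ring

/-- `v₁ M_1 = M_2 d` on a horizontal section. -/
theorem v1_M1At (l : ι) (V : X.Opens) (hl : V ≤ C.U l) {s : Sec L V}
    (hs : ∀ a, D.br V a s = 0) {x : (Fn X V → Fn X V) × (Fn X V → Fn X V → Fn X V)}
    (hx' : IsBiDer f x.2) (y z : Fn X V) :
    v1 D V (M1At C l V hl x s) y z =
      (C.coord l V hl s * (dE1 D C l V hl x).1 y z +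
        (dE1 D C l V hl x).2 (C.coord l V hl s) y z) • C.eAt l V hl := by
  have hf := flat_coord D C l V hl hs
  simp only [v1, M1At, br_coord, ← sub_smul]
  congr 1
  generalize C.coord l V hl s = σ at *
  generalize hT : vecT D C l V hl = T at *
  have e4 : ∀ w w', x.2 (P.br V σ w) w' = σ * x.2 (T w) w' + T w * x.2 σ w' := by
    intro w w'
    rw [P.skew V σ w, hf w, neg_neg, (hx'.der w').leibniz]; simp only [smul_eq_mul]
  simp only [dE1, AddMonoidHom.mk'_apply, hT, sch12, sch21, sch22, P.add_right, P.leibniz_right]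
  rw [e4, e4, hf y, hf z, hf (x.2 y z), P.skew V (x.2 σ y) z, P.skew V (x.2 σ z) y,
    hx'.skew (P.br V y z) σ, P.skew V (x.1 y) z, P.skew V (x.1 z) y]
  ring

theorem H0_flat (s : H0 D) (V : X.Opens) (a : Fn X V) : D.br V a (rm L le_top s.1) = 0 :=
  s.2 V a

/-- `M` on Čech 1-cochains: `(x, y)` and `s` are sent to
`({M_1(x_i)(s)}, {M_0(y_ij)(s)})`, where `x_i` is read in the chart `i` and `y_ij` in the
chart `j`. -/
def MCoch (c : CochE f C) (s : Sec L ⊤) : CochL f C :=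
  (fun i => ⟨fun V => M1At C i V.1 V.2 ((c.1 i).1 i ⟨V.1, V.2, V.2⟩) (rm L le_top s),
    fun V => M1At_isDer C ((c.1 i).2.1 i V.1 V.2 V.2).1 ((c.1 i).2.1 i V.1 V.2 V.2).2 _,
    fun V W h hW a => by rw [M1At_res C (c.1 i) i h hW hW, rm_rm]⟩,
  fun i j => M0At C j (C.U i ⊓ C.U j) inf_le_right ((c.2 i j).1 j ⟨_, le_rfl, inf_le_right⟩)
    (rm L le_top s))

theorem MCoch_snd (c : CochE f C) (s : Sec L ⊤) (i j l : ι) (V : X.Opens) (hi : V ≤ C.U i)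
    (hj : V ≤ C.U j) (hl : V ≤ C.U l) :
    rm L (le_inf hi hj) ((MCoch C c s).2 i j) =
      M0At C l V hl ((c.2 i j).1 l ⟨V, le_inf hi hj, hl⟩) (rm L le_top s) := by
  rw [MCoch, M0At_res C (c.2 i j) j (le_inf hi hj) le_rfl inf_le_right, rm_rm,
    M0At_chart C (c.2 i j) l j V (le_inf hi hj) hl hj]

theorem MCoch_fst (c : CochE f C) (s : Sec L ⊤) (i l : ι) (V : X.Opens) (hi : V ≤ C.U i)
    (hl : V ≤ C.U l) (a : Fn X V) :
    ((MCoch C c s).1 i).1 ⟨V, hi⟩ a =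
      M1At C l V hl ((c.1 i).1 l ⟨V, hi, hl⟩) (rm L le_top s) a :=
  M1At_chart C (c.1 i) i l V hi hi hl _ a

theorem MCoch_add_left (c c' : CochE f C) (s : Sec L ⊤) :
    MCoch C (c + c') s = MCoch C c s + MCoch C c' s := by
  apply Prod.ext
  · funext i
    apply Subtype.ext
    funext V a
    exact M1At_add_left C i V.1 V.2 _ _ _ a
  · funext i j
    exact M0At_add_left C j _ _ _ _ _

theorem MCoch_add_right (c : CochE f C) (s t : Sec L ⊤) :
    MCoch C c (s + t) = MCoch C c s + MCoch C c t := by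
  apply Prod.ext
  · funext i
    apply Subtype.ext
    funext V a
    refine (congrArg (fun w => M1At C i V.1 V.2 _ w a) (map_add _ s t)).trans ?_
    exact M1At_add_right C ((c.1 i).2.1 i V.1 V.2 V.2).2 _ _ a
  · funext i j
    refine (congrArg (fun w => M0At C j _ _ _ w) (map_add _ s t)).trans ?_
    exact M0At_add_right C ((c.2 i j).2.1 j _ le_rfl inf_le_right) _ _

theorem MCoch_mem (c : Z1E D C) (s : H0 D) : MCoch C c.1 s.1 ∈ Z1L D C := by
  obtain ⟨h1, h2, h3⟩ := c.2
  refine ⟨fun i V h a b => ?_, fun i j V hi hj a => ?_, fun i j k V hi hj hk => ?_⟩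
  · have := v1_M1At D C i V h (H0_flat D s V) ((c.1.1 i).2.1 i V h h).2 a b
    rw [h1 i i V h h] at this
    refine this.trans ?_
    simp
  · have e := h2 i j j V hi hj hj
    have hv : ((v0 D _ ((MCoch C c.1 s.1).2 i j) : L1 f L _).1 ⟨V, le_inf hi hj⟩ a) =
        D.br V a (rm L (le_inf hi hj) ((MCoch C c.1 s.1).2 i j)) := rfl
    rw [hv, MCoch_snd C c.1 s.1 i j j V hi hj hj, MCoch_fst C c.1 s.1 j j V hj hj,
      MCoch_fst C c.1 s.1 i j V hi hj,
      br_M0At D C j V hj (H0_flat D s V) ((c.1.2 i j).2.1 j V (le_inf hi hj) hj)]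
    have e' : (c.1.1 j).1 j ⟨V, hj, hj⟩ =
        (c.1.1 i).1 j ⟨V, hi, hj⟩ +
          -(dE0 D C j V hj ((c.1.2 i j).1 j ⟨V, le_inf hi hj, hj⟩)) := by
      rw [← sub_eq_iff_eq_add', eq_neg_iff_add_eq_zero]; exact e
    have e'' := congrArg (fun w => M1At C j V hj w (rm L le_top s.1) a)
      (sub_eq_iff_eq_add'.mp (eq_neg_of_add_eq_zero_left e))
    have z := M1At_add_left C j V hj (dE0 D C j V hj ((c.1.2 i j).1 j ⟨V, le_inf hi hj, hj⟩))
      (-(dE0 D C j V hj ((c.1.2 i j).1 j ⟨V, le_inf hi hj, hj⟩))) (rm L le_top s.1) a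
    rw [add_neg_cancel] at z
    have z0 : M1At C j V hj 0 (rm L le_top s.1) a = 0 := by simp [M1At]
    rw [z0] at z
    simp only [M1At_add_left] at e''
    rw [e'', eq_neg_of_add_eq_zero_right z.symm]
    abel
  · have e := h3 i j k k V hi hj hk hk
    rw [MCoch_snd C c.1 s.1 j k k V hj hk hk, MCoch_snd C c.1 s.1 i k k V hi hk hk,
      MCoch_snd C c.1 s.1 i j k V hi hj hk]
    have e' : (c.1.2 j k).1 k ⟨V, le_inf hj hk, hk⟩ + (c.1.2 i j).1 k ⟨V, le_inf hi hj, hk⟩ =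
        (c.1.2 i k).1 k ⟨V, le_inf hi hk, hk⟩ := by
      rw [← sub_eq_zero, ← e]; abel
    rw [← e', M0At_add_left]
    abel

theorem MCoch_bdry {c : CochE f C} (hc : c ∈ B1E D C) (s : H0 D) :
    MCoch C c s.1 ∈ B1L D C := by
  obtain ⟨z, h1, h2⟩ := hc
  refine ⟨fun i => -M0At C i (C.U i) le_rfl ((z i).1 i ⟨_, le_rfl, le_rfl⟩) (rm L le_top s.1),
    fun i => ?_, fun i j => ?_⟩
  · apply Subtype.ext
    funext V a
    have hv : (v0 D (C.U i) (-M0At C i (C.U i) le_rfl ((z i).1 i ⟨_, le_rfl, le_rfl⟩)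
        (rm L le_top s.1)) : L1 f L _).1 V a =
        D.br V.1 a (rm L V.2 (-M0At C i (C.U i) le_rfl ((z i).1 i ⟨_, le_rfl, le_rfl⟩)
        (rm L le_top s.1))) := rfl
    rw [hv, map_neg, M0At_res C (z i) i V.2 le_rfl le_rfl, rm_rm, br_neg,
      br_M0At D C i V.1 V.2 (H0_flat D s V.1) ((z i).2.1 i V.1 V.2 V.2), neg_neg,
      ← h1 i i V.1 V.2 V.2]
    rfl
  · have e := h2 i j j (C.U i ⊓ C.U j) inf_le_left inf_le_right inf_le_right
    rw [map_neg, map_neg, M0At_res C (z j) j inf_le_right le_rfl le_rfl,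
      M0At_res C (z i) i inf_le_left le_rfl le_rfl, rm_rm, rm_rm,
      M0At_chart C (z i) i j _ inf_le_left inf_le_left inf_le_right]
    have e' : (c.2 i j).1 j ⟨C.U i ⊓ C.U j, le_rfl, inf_le_right⟩ +
        (z j).1 j ⟨C.U i ⊓ C.U j, inf_le_right, inf_le_right⟩ =
        (z i).1 j ⟨C.U i ⊓ C.U j, inf_le_left, inf_le_right⟩ := by
      rw [e]; abel
    rw [← e', M0At_add_left]
    simp only [MCoch]
    abel

/-- The homomorphism `M_1 : ℍ¹(X, Λ, 𝓔_L^•) → Hom(ℍ⁰(X, Λ, L^•, ∇), ℍ¹(X, Λ, L^•, ∇))`. -/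
def M1 : H1E D C →+ H0 D →+ H1L D C :=
  QuotientAddGroup.lift _
    (AddMonoidHom.mk'
      (fun c : Z1E D C => AddMonoidHom.mk'
        (fun s : H0 D => (QuotientAddGroup.mk ⟨MCoch C c.1 s.1, MCoch_mem D C c s⟩ : H1L D C))
        (fun s t => congrArg QuotientAddGroup.mk (Subtype.ext (MCoch_add_right C c.1 s.1 t.1))))
      (fun c c' => by
        ext s
        exact congrArg QuotientAddGroup.mk (Subtype.ext (MCoch_add_left C c.1 c'.1 s.1))))
    (fun c hc => by
      ext s
      exact (QuotientAddGroup.eq_zero_iff _).mpr (MCoch_bdry D C hc s))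

end complexes

/-! ### First-order simultaneous deformations -/

/-- The closed point `Spec k → Spec k[ε]`. -/
def closedPoint (k : Type u) [Field k] : Spec (.of k) ⟶ Spec (.of (DualNumber k)) :=
  Spec.map (CommRingCat.ofHom (TrivSqZeroExt.fstHom k k k).toRingHom)

/-- A first-order deformation `(𝒳, Λ, ℒ, ∇_ℒ)` of `(X, Λ₀, L, ∇)` over `Spec k[ε]`. -/
structure FirstOrderDeformation {k : Type u} [Field k] {X : Scheme.{u}} {f : X ⟶ Spec (.of k)}
    (P : PoissonStructure f) {L : X.Modules} (D : FlatPoissonConnection P L) where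
  /-- the total space `𝒳` -/
  tot : Scheme.{u}
  /-- the structure morphism `𝒳 → Spec k[ε]` -/
  str : tot ⟶ Spec (.of (DualNumber k))
  flat : Flat str
  /-- the inclusion `X → 𝒳` of the closed fibre -/
  incl : X ⟶ tot
  isPullback : IsPullback incl f str (closedPoint k)
  /-- the Poisson structure on `𝒳` over `k[ε]` -/
  poisson : PoissonStructure str
  incl_poisson : ∀ (W : tot.Opens) (a b : Fn tot W),
    incl.app W (poisson.br W a b) = P.br (incl ⁻¹ᵁ W) (incl.app W a) (incl.app W b)
  /-- the invertible sheaf `ℒ` -/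
  sheaf : tot.Modules
  invertible : IsInvertibleSheaf sheaf
  /-- the flat Poisson connection on `ℒ` over `k[ε]` -/
  conn : FlatPoissonConnection poisson sheaf
  /-- the restriction `ℒ → incl_* L` of sections to `X` -/
  restr : sheaf ⟶ (Scheme.Modules.pushforward incl).obj L
  /-- the morphism `incl^* ℒ → L` adjoint to the restriction is an isomorphism -/
  restr_iso : IsIso
    (((Scheme.Modules.pullbackPushforwardAdjunction incl).homEquiv sheaf L).symm restr)
  restr_conn : ∀ (W : tot.Opens) (a : Fn tot W) (s : Sec sheaf W),
    (restr.app W (conn.br W a s) : Sec L (incl ⁻¹ᵁ W)) =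
      D.br (incl ⁻¹ᵁ W) (incl.app W a) (restr.app W s)

namespace FirstOrderDeformation

variable {k : Type u} [Field k] {X : Scheme.{u}} {f : X ⟶ Spec (.of k)}
  {P : PoissonStructure f} {L : X.Modules} {D : FlatPoissonConnection P L}
  (T : FirstOrderDeformation P D) {ι : Type v} (C : FramedCover L ι)

/-- `s ∈ ℍ⁰(X, Λ₀, L^•, ∇)` extends to `ℍ⁰(𝒳, Λ, ℒ^•, ∇_ℒ)`. -/
def Extends (s : H0 D) : Prop :=
  ∃ t : H0 T.conn, (T.restr.app ⊤ t.1 : Sec L ⊤) = s.1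

/-- A trivialisation of `(𝒳, ℒ)` over `U i`: an isomorphism `𝒳|_{U i} ≅ U i × Spec k[ε]` over
`k[ε]` extending the identity of `U i`, given by the isomorphism `θ` of sheaves of
`k[ε]`-algebras, and a frame of `ℒ` which lifts the frame `e i` of `L`. Here `W` runs through the
opens of `𝒳` (which has the same underlying space as `X`) whose trace on `X` lies in `U i`. -/
structure LocalTriv (i : ι) where
  θ : ∀ W : T.tot.Opens, T.incl ⁻¹ᵁ W ≤ C.U i →
    Fn T.tot W ≃+* DualNumber (Fn X (T.incl ⁻¹ᵁ W))
  θ_const : ∀ W h (r : DualNumber k),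
    θ W h (cst T.str W r) = (cst f _ r.fst, cst f _ r.snd)
  θ_fst : ∀ W h (a : Fn T.tot W), (θ W h a).fst = T.incl.app W a
  θ_res : ∀ (V W : T.tot.Opens) (hVW : V ≤ W) (hX : T.incl ⁻¹ᵁ V ≤ T.incl ⁻¹ᵁ W) h
    (a : Fn T.tot W),
    θ V (hX.trans h) (rs hVW a) = (rs hX (θ W h a).fst, rs hX (θ W h a).snd)
  E : ∀ W : T.tot.Opens, T.incl ⁻¹ᵁ W ≤ C.U i → Sec T.sheaf W
  E_res : ∀ (V W : T.tot.Opens) (hVW : V ≤ W) (hX : T.incl ⁻¹ᵁ V ≤ T.incl ⁻¹ᵁ W) h,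
    rm T.sheaf hVW (E W h) = E V (hX.trans h)
  E_lift : ∀ W h, (T.restr.app W (E W h) : Sec L (T.incl ⁻¹ᵁ W)) = C.eAt i _ h
  E_frame : ∀ W h, IsFrame T.sheaf (E W h)

/-- The function `a + ε b` on `W`, in a trivialisation over `U i`. -/
def LocalTriv.fn {T : FirstOrderDeformation P D} {C : FramedCover L ι} {i : ι}
    (τ : LocalTriv T C i) (W : T.tot.Opens) (h : T.incl ⁻¹ᵁ W ≤ C.U i)
    (a b : Fn X (T.incl ⁻¹ᵁ W)) : Fn T.tot W :=
  (τ.θ W h).symm (TrivSqZeroExt.inl a + TrivSqZeroExt.inr b)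

/-- The cocycle `({(W_i, -Λ_i)}, {(a_ij, p_ij)})` (the first pair read in the chart `i`, the second
one in the chart `j`) of a system of trivialisations:
* the Poisson structure is `Λ₀ + ε Λ_i` in the trivialisation over `U i`;
* the connection is given by `T_i + ε W_i` in the frame `E_i`;
* the change of trivialisation `θ_i θ_j⁻¹` is `id + ε p_ij`;
* the transition function is `f_ij + ε f_ij a_ij`, i.e. `E_j = (f_ij + ε f_ij a_ij) E_i`, as a
  function in the trivialisation over `U i`. -/
structure IsCocycleOf (τ : ∀ i, LocalTriv T C i) (c : CochE f C) : Prop where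
  poisson : ∀ i W (h : T.incl ⁻¹ᵁ W ≤ C.U i) (a b : Fn X (T.incl ⁻¹ᵁ W)),
    T.poisson.br W ((τ i).fn W h a 0) ((τ i).fn W h b 0) =
      (τ i).fn W h (P.br _ a b) (-((c.1 i).1 i ⟨_, h, h⟩).2 a b)
  conn : ∀ i W (h : T.incl ⁻¹ᵁ W ≤ C.U i) (a : Fn X (T.incl ⁻¹ᵁ W)),
    T.conn.br W ((τ i).fn W h a 0) ((τ i).E W h) =
      (τ i).fn W h (vecT D C i _ h a) (((c.1 i).1 i ⟨_, h, h⟩).1 a) • (τ i).E W h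
  change : ∀ i j W (hi : T.incl ⁻¹ᵁ W ≤ C.U i) (hj : T.incl ⁻¹ᵁ W ≤ C.U j)
    (a : Fn X (T.incl ⁻¹ᵁ W)),
    (τ j).fn W hj a 0 = (τ i).fn W hi a (((c.2 i j).1 j ⟨_, le_inf hi hj, hj⟩).2 a)
  trans : ∀ i j W (hi : T.incl ⁻¹ᵁ W ≤ C.U i) (hj : T.incl ⁻¹ᵁ W ≤ C.U j),
    (τ j).E W hj =
      (τ i).fn W hi (C.trans i j _ hi hj)
        (C.trans i j _ hi hj * ((c.2 i j).1 j ⟨_, le_inf hi hj, hj⟩).1) • (τ i).E W hi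

/-- The deformation is defined by the class `η ∈ ℍ¹(X, Λ₀, 𝓔_L^•)`. -/
def IsDefinedBy (η : H1E D C) : Prop :=
  ∃ (τ : ∀ i, LocalTriv T C i) (c : Z1E D C), T.IsCocycleOf C τ c.1 ∧ QuotientAddGroup.mk c = η

end FirstOrderDeformation

end PoissonDeformation

end

open PoissonDeformation

/-!
A trivialisation of `(𝒳, ℒ)` over `U_i` writes each section of `ℒ` over an open `W` of `𝒳` lying
over `U_i` uniquely as `s + ε z`, with sections `s` and `z` of `L` over the trace of `W` on `X`.
The cocycle `(x, y)` of the deformation governs how these expressions behave: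
* `{a, s + ε z} = {a, s} + ε ({a, z} + M₁(x_i)(s)(a))` in the trivialisation over `U_i`;
* `s + ε z` in the trivialisation over `U_j` is `s + ε (z + M₀(y_ij)(s))` in the one over `U_i`.

Hence a horizontal lift of a horizontal section `s` is the same thing as a family of sections `z_i`
of `L` over the `U_i` such that `M₁(x_i)(s) = -∇ z_i` and `M₀(y_ij)(s) = z_i - z_j`, i.e. such
that the Čech cocycle representing `M₁(η)(s)` is the coboundary of `{-z_i}`.
-/

namespace PoissonDeformation

section Sheaf

variable {X : Scheme.{u}} (M : X.Modules)

theorem rm_self {V : X.Opens} (h : V ≤ V) (s : Sec M V) : rm M h s = s :=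
  congr($(M.presheaf.map_id _) s)

variable {κ : Type*} {W : κ → X.Opens} {V : X.Opens} (hW : ∀ i, W i ≤ V) (hcover : V ≤ ⨆ i, W i)
include hcover

theorem eq_of_forall_rm_eq {s t : Sec M V} (h : ∀ i, rm M (hW i) s = rm M (hW i) t) : s = t :=
  TopCat.Sheaf.eq_of_locally_eq' ⟨M.presheaf, M.isSheaf⟩ W V (fun i => homOfLE (hW i)) hcover s t h

theorem exists_forall_rm_eq (t : ∀ i, Sec M (W i))
    (h : ∀ i j, rm M (inf_le_left : W i ⊓ W j ≤ W i) (t i) = rm M inf_le_right (t j)) :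
    ∃ s : Sec M V, ∀ i, rm M (hW i) s = t i :=
  (TopCat.Sheaf.existsUnique_gluing' ⟨M.presheaf, M.isSheaf⟩ W V (fun i => homOfLE (hW i))
    hcover t h).exists

end Sheaf

section Preimage

variable {X Y : Scheme.{u}} (g : X ⟶ Y)

theorem exists_preimage_eq [IsPreimmersion g] (V : X.Opens) : ∃ W : Y.Opens, g ⁻¹ᵁ W = V := by
  obtain ⟨W, hW, h⟩ := g.isEmbedding.isOpen_iff.mp V.isOpen
  exact ⟨⟨W, hW⟩, TopologicalSpace.Opens.ext h⟩

theorem le_of_preimage_le [Surjective g] {V W : Y.Opens} (h : g ⁻¹ᵁ V ≤ g ⁻¹ᵁ W) : V ≤ W := by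
  intro y hy
  obtain ⟨x, rfl⟩ := g.surjective y
  exact h hy

end Preimage

section PoissonModule

variable {R : Type u} [CommRing R] {X : Scheme.{u}} {f : X ⟶ Spec (.of R)}
  {P : PoissonStructure f} {L : X.Modules} (D : FlatPoissonConnection P L)
  {ι : Type v} (C : FramedCover L ι)

theorem PoissonStructure.const_right (V : X.Opens) (r : R) (a b : Fn X V) :
    P.br V a (cst f V r * b) = cst f V r * P.br V a b := by
  rw [P.skew, P.const_left, P.skew V b, mul_neg, neg_neg]

theorem FramedCover.coord_injective (i : ι) (V : X.Opens) (h : V ≤ C.U i) :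
    Function.Injective (C.coord i V h) :=
  Equiv.injective _

theorem FramedCover.coord_zero (i : ι) (V : X.Opens) (h : V ≤ C.U i) : C.coord i V h 0 = 0 :=
  C.coord_eq i V h (zero_smul _ _)

theorem coord_br (i : ι) (V : X.Opens) (h : V ≤ C.U i) (a : Fn X V) (s : Sec L V) :
    C.coord i V h (D.br V a s) = P.br V a (C.coord i V h s) + C.coord i V h s * vecT D C i V h a :=
  C.coord_eq i V h (by rw [← br_coord, C.coord_smul])

theorem coord_M0At (i : ι) (V : X.Opens) (h : V ≤ C.U i) (x : Fn X V × (Fn X V → Fn X V))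
    (s : Sec L V) :
    C.coord i V h (M0At C i V h x s) = C.coord i V h s * x.1 + x.2 (C.coord i V h s) :=
  C.coord_eq i V h rfl

theorem coord_M1At (i : ι) (V : X.Opens) (h : V ≤ C.U i)
    (x : (Fn X V → Fn X V) × (Fn X V → Fn X V → Fn X V)) (s : Sec L V) (a : Fn X V) :
    C.coord i V h (M1At C i V h x s a) = C.coord i V h s * x.1 a + x.2 (C.coord i V h s) a :=
  C.coord_eq i V h rfl

theorem mem_H0_iff_of_cover {κ : Type*} {U : κ → X.Opens} (hU : ⨆ i, U i = ⊤) (s : Sec L ⊤) :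
    s ∈ H0 D ↔ ∀ i, ∀ V ≤ U i, ∀ a, D.br V a (rm L le_top s) = 0 := by
  refine ⟨fun hs _ V _ a => hs V a, fun hs V a => ?_⟩
  have hcover : V ≤ ⨆ i, V ⊓ U i := by rw [← inf_iSup_eq, hU, inf_top_eq]
  refine eq_of_forall_rm_eq L (fun _ => inf_le_left) hcover fun i => ?_
  rw [D.res, rm_rm, map_zero, hs i _ inf_le_right]

theorem MCoch_mem_B1L_iff (c : CochE f C) (s : Sec L ⊤) :
    MCoch C c s ∈ B1L D C ↔ ∃ z : ∀ i, Sec L (C.U i),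
      (∀ i V (h : V ≤ C.U i) a,
        D.br V a (rm L h (z i)) +
          M1At C i V h ((c.1 i).1 i ⟨V, h, h⟩) (rm L le_top s) a = 0) ∧
      ∀ i j V (hi : V ≤ C.U i) (hj : V ≤ C.U j),
        rm L hj (z j) + M0At C j V hj ((c.2 i j).1 j ⟨V, le_inf hi hj, hj⟩) (rm L le_top s) =
          rm L hi (z i) := by
  constructor
  · rintro ⟨z, hx, hy⟩
    refine ⟨-z, fun i V h a => ?_, fun i j V hi hj => ?_⟩
    · have hM₁ : M1At C i V h ((c.1 i).1 i ⟨V, h, h⟩) (rm L le_top s) a =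
          D.br V a (rm L h (z i)) :=
        congrArg (fun w : L1 f L (C.U i) => w.1 ⟨V, h⟩ a) (hx i)
      rw [hM₁, Pi.neg_apply, map_neg, br_neg, neg_add_cancel]
    · rw [← MCoch_snd C c s i j j V hi hj hj, hy, map_sub, rm_rm, rm_rm, Pi.neg_apply, Pi.neg_apply,
        map_neg, map_neg]
      abel
  · rintro ⟨z, hx, hy⟩
    refine ⟨-z, fun i => Subtype.ext (funext₂ fun V a => ?_), fun i j => ?_⟩
    · change M1At C i V.1 V.2 _ (rm L le_top s) a = D.br V.1 a (rm L V.2 (-z i))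
      rw [map_neg, br_neg]
      exact eq_neg_of_add_eq_zero_right (hx i V.1 V.2 a)
    · have hM₀ := MCoch_snd C c s i j j _ inf_le_left inf_le_right inf_le_right
      rw [rm_self] at hM₀
      rw [hM₀, Pi.neg_apply, Pi.neg_apply, map_neg, map_neg,
        ← hy i j _ inf_le_left inf_le_right]
      abel

theorem M1_mk_apply_eq_zero_iff (c : Z1E D C) (s : H0 D) :
    M1 D C (QuotientAddGroup.mk c) s = 0 ↔ MCoch C c.1 s.1 ∈ B1L D C :=
  QuotientAddGroup.eq_zero_iff (N := (B1L D C).addSubgroupOf (Z1L D C))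
    ⟨MCoch C c.1 s.1, MCoch_mem D C c s⟩

end PoissonModule

section ClosedPoint

variable (k : Type u) [Field k]

instance : IsClosedImmersion (closedPoint k) :=
  IsClosedImmersion.spec_of_surjective _ TrivSqZeroExt.fst_surjective

instance : Surjective (closedPoint k) := by
  refine ⟨(PrimeSpectrum.isHomeomorph_comap (TrivSqZeroExt.fstHom k k k).toRingHom
    (fun x => ⟨1, one_pos, .inl (x ^ 1), rfl⟩) fun x hx => ?_).surjective⟩
  exact TrivSqZeroExt.isNilpotent_iff_isNilpotent_fst.mpr ⟨1, (pow_one _).trans hx⟩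

end ClosedPoint

namespace FirstOrderDeformation

variable {k : Type u} [Field k] {X : Scheme.{u}} {f : X ⟶ Spec (.of k)}
  {P : PoissonStructure f} {L : X.Modules} {D : FlatPoissonConnection P L}
  (T : FirstOrderDeformation P D) {ι : Type v} (C : FramedCover L ι)

instance : IsClosedImmersion T.incl :=
  MorphismProperty.of_isPullback (P := @IsClosedImmersion) T.isPullback.flip inferInstance

instance : Surjective T.incl :=
  MorphismProperty.of_isPullback (P := @Surjective) T.isPullback.flip inferInstance

/-- The restriction of sections of `ℒ` to the closed fibre `X`, as a homomorphism on the sections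
over each open of `𝒳`. -/
noncomputable def restrHom (W : T.tot.Opens) : Sec T.sheaf W →+ Sec L (T.incl ⁻¹ᵁ W) :=
  (T.restr.app W).hom

theorem restrHom_smul (W : T.tot.Opens) (a : Fn T.tot W) (t : Sec T.sheaf W) :
    T.restrHom W (a • t) = T.incl.app W a • T.restrHom W t :=
  Scheme.Modules.Hom.app_smul T.restr a t

theorem restrHom_rm {V W : T.tot.Opens} (h : V ≤ W) (t : Sec T.sheaf W) :
    T.restrHom V (rm T.sheaf h t) = rm L (T.incl.preimage_mono h) (T.restrHom W t) :=
  congr($(T.restr.mapPresheaf.naturality (homOfLE h).op) t)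

theorem restrHom_rm_top {s : Sec L ⊤} {t : Sec T.sheaf ⊤} (ht : T.restrHom ⊤ t = s)
    (W : T.tot.Opens) : T.restrHom W (rm T.sheaf le_top t) = rm L le_top s :=
  (T.restrHom_rm le_top t).trans (congrArg _ ht)

theorem exists_cover_preimage_eq :
    ∃ W : ι → T.tot.Opens, (∀ i, T.incl ⁻¹ᵁ W i = C.U i) ∧ ⨆ i, W i = ⊤ := by
  choose W hW using fun i => exists_preimage_eq T.incl (C.U i)
  refine ⟨W, hW, top_le_iff.mp (le_of_preimage_le T.incl ?_)⟩
  simp only [Scheme.Hom.preimage_iSup, hW, C.cover, le_top]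

namespace LocalTriv

variable {T C} {i : ι} (τ : LocalTriv T C i) {W : T.tot.Opens} (h : T.incl ⁻¹ᵁ W ≤ C.U i)

theorem θ_fn (a b : Fn X (T.incl ⁻¹ᵁ W)) :
    τ.θ W h (τ.fn W h a b) = TrivSqZeroExt.inl a + TrivSqZeroExt.inr b :=
  (τ.θ W h).apply_symm_apply _

theorem fn_θ (x : Fn T.tot W) : τ.fn W h (τ.θ W h x).fst (τ.θ W h x).snd = x := by
  rw [fn, TrivSqZeroExt.inl_fst_add_inr_snd_eq, RingEquiv.symm_apply_apply]

theorem fn_inj {a b a' b' : Fn X (T.incl ⁻¹ᵁ W)} :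
    τ.fn W h a b = τ.fn W h a' b' ↔ a = a' ∧ b = b' := by
  rw [← (τ.θ W h).injective.eq_iff, θ_fn, θ_fn, TrivSqZeroExt.ext_iff]
  simp

theorem fn_zero : τ.fn W h 0 0 = 0 := by simp [fn]

theorem fn_add (a b a' b' : Fn X (T.incl ⁻¹ᵁ W)) :
    τ.fn W h a b + τ.fn W h a' b' = τ.fn W h (a + a') (b + b') := by
  apply (τ.θ W h).injective
  rw [map_add, θ_fn, θ_fn, θ_fn]
  ext <;> simp

theorem fn_mul (a b a' b' : Fn X (T.incl ⁻¹ᵁ W)) :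
    τ.fn W h a b * τ.fn W h a' b' = τ.fn W h (a * a') (a * b' + a' * b) := by
  apply (τ.θ W h).injective
  rw [map_mul, θ_fn, θ_fn, θ_fn]
  ext <;> simp [mul_comm]

theorem cst_eps : cst T.str W DualNumber.eps = τ.fn W h 0 1 := by
  apply (τ.θ W h).injective
  rw [θ_fn, τ.θ_const W h]
  ext <;> simp

theorem cst_eps_mul_fn (a b : Fn X (T.incl ⁻¹ᵁ W)) :
    cst T.str W DualNumber.eps * τ.fn W h a b = τ.fn W h 0 a := by
  rw [τ.cst_eps h, fn_mul]
  simp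

theorem fn_eq_add_eps_mul (a b : Fn X (T.incl ⁻¹ᵁ W)) :
    τ.fn W h a b = τ.fn W h a 0 + cst T.str W DualNumber.eps * τ.fn W h b 0 := by
  rw [cst_eps_mul_fn, fn_add, add_zero, zero_add]

theorem app_fn (a b : Fn X (T.incl ⁻¹ᵁ W)) : T.incl.app W (τ.fn W h a b) = a := by
  rw [← τ.θ_fst W h, θ_fn]
  simp

theorem rs_fn {V : T.tot.Opens} (hV : V ≤ W) (a b : Fn X (T.incl ⁻¹ᵁ W)) :
    rs hV (τ.fn W h a b) = τ.fn V ((T.incl.preimage_mono hV).trans h)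
      (rs (T.incl.preimage_mono hV) a) (rs (T.incl.preimage_mono hV) b) := by
  apply (τ.θ V ((T.incl.preimage_mono hV).trans h)).injective
  rw [τ.θ_res V W hV (T.incl.preimage_mono hV) h, θ_fn, θ_fn]
  ext <;> simp

theorem smul_E_bijective : Function.Bijective fun x : Fn T.tot W => x • τ.E W h := by
  simpa only [rm_self] using τ.E_frame W h W le_rfl

theorem br_eq_zero_iff (t : Sec T.sheaf W) :
    (∀ x, T.conn.br W x t = 0) ↔ ∀ a, T.conn.br W (τ.fn W h a 0) t = 0 := by
  refine ⟨fun ht a => ht _, fun ht x => ?_⟩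
  rw [← τ.fn_θ h x, fn_eq_add_eps_mul, T.conn.add_left, T.conn.const_left, ht, ht, smul_zero,
    add_zero]

/-- The section `s + ε z` of `ℒ` over `W` in a trivialisation over `U i`, for sections `s` and `z`
of `L` over the trace of `W` on `X`: its coordinate in the frame `E` is `s_i + ε z_i`. -/
noncomputable def sec (s z : Sec L (T.incl ⁻¹ᵁ W)) : Sec T.sheaf W :=
  τ.fn W h (C.coord i _ h s) (C.coord i _ h z) • τ.E W h

theorem sec_inj {s z s' z' : Sec L (T.incl ⁻¹ᵁ W)} :
    τ.sec h s z = τ.sec h s' z' ↔ s = s' ∧ z = z' := by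
  rw [sec, sec, (τ.smul_E_bijective h).1.eq_iff, fn_inj, (C.coord_injective i _ h).eq_iff,
    (C.coord_injective i _ h).eq_iff]

theorem sec_zero : τ.sec h 0 0 = 0 := by
  rw [sec, C.coord_zero, fn_zero, zero_smul]

theorem rm_sec {V : T.tot.Opens} (hV : V ≤ W) (s z : Sec L (T.incl ⁻¹ᵁ W)) :
    rm T.sheaf hV (τ.sec h s z) = τ.sec ((T.incl.preimage_mono hV).trans h)
      (rm L (T.incl.preimage_mono hV) s) (rm L (T.incl.preimage_mono hV) z) := by
  rw [sec, rm_smul, τ.rs_fn h hV, τ.E_res V W hV (T.incl.preimage_mono hV) h, C.rs_coord,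
    C.rs_coord, sec]

theorem restrHom_sec (s z : Sec L (T.incl ⁻¹ᵁ W)) : T.restrHom W (τ.sec h s z) = s := by
  rw [sec, restrHom_smul, app_fn]
  exact (congrArg _ (τ.E_lift W h)).trans (C.coord_smul i _ h s)

theorem exists_eq_sec (t : Sec T.sheaf W) : ∃ z, t = τ.sec h (T.restrHom W t) z := by
  obtain ⟨x, rfl⟩ := (τ.smul_E_bijective h).2 t
  have hx : x • τ.E W h =
      τ.sec h ((τ.θ W h x).fst • C.eAt i _ h) ((τ.θ W h x).snd • C.eAt i _ h) := by
    rw [sec, C.coord_eq i _ h rfl, C.coord_eq i _ h rfl, τ.fn_θ h x]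
  exact ⟨(τ.θ W h x).snd • C.eAt i _ h, by simp only [hx, restrHom_sec]⟩

theorem exists_forall_rm_eq_sec {s : Sec L ⊤} {t : Sec T.sheaf ⊤} (ht : T.restrHom ⊤ t = s) :
    ∃ z : Sec L (C.U i), ∀ W h,
      rm T.sheaf le_top t = τ.sec (W := W) h (rm L le_top s) (rm L h z) := by
  obtain ⟨W, hW⟩ := exists_preimage_eq T.incl (C.U i)
  obtain ⟨z, hz⟩ := τ.exists_eq_sec hW.le (rm T.sheaf le_top t)
  rw [T.restrHom_rm_top ht] at hz
  refine ⟨rm L hW.ge z, fun V h => ?_⟩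
  have hV : V ≤ W := le_of_preimage_le T.incl (h.trans hW.ge)
  rw [← rm_rm T.sheaf hV le_top, hz, rm_sec, rm_rm, rm_rm]

end LocalTriv

variable {T C}

theorem exists_restrHom_eq_of_compatible (τ : ∀ i, LocalTriv T C i) (s : Sec L ⊤)
    (z : ∀ i, Sec L (C.U i))
    (hz : ∀ i j (W : T.tot.Opens) (hi : T.incl ⁻¹ᵁ W ≤ C.U i) (hj : T.incl ⁻¹ᵁ W ≤ C.U j),
      (τ i).sec hi (rm L le_top s) (rm L hi (z i)) =
        (τ j).sec hj (rm L le_top s) (rm L hj (z j))) :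
    ∃ t : Sec T.sheaf ⊤, T.restrHom ⊤ t = s ∧ ∀ i W h,
      rm T.sheaf le_top t = (τ i).sec (W := W) h (rm L le_top s) (rm L h (z i)) := by
  obtain ⟨W, hW, hcover⟩ := T.exists_cover_preimage_eq C
  obtain ⟨t, ht⟩ := exists_forall_rm_eq T.sheaf (fun _ => le_top) hcover.ge
    (fun i => (τ i).sec (hW i).le (rm L le_top s) (rm L (hW i).le (z i)))
    (fun i j => by simp only [LocalTriv.rm_sec, rm_rm]; exact hz i j _ _ _)
  have ht' : ∀ i V h, rm T.sheaf le_top t =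
      (τ i).sec (W := V) h (rm L le_top s) (rm L h (z i)) := fun i V h => by
    have hV : V ≤ W i := le_of_preimage_le T.incl (h.trans (hW i).ge)
    rw [← rm_rm T.sheaf hV le_top, ht, LocalTriv.rm_sec, rm_rm, rm_rm]
  have hcover' : ⨆ i, T.incl ⁻¹ᵁ W i = ⊤ := by simp only [hW, C.cover]
  refine ⟨t, eq_of_forall_rm_eq L (fun _ => le_top) hcover'.ge fun i => ?_, ht'⟩
  exact (T.restrHom_rm_top rfl (W i)).symm.trans
    ((congrArg _ (ht i)).trans (LocalTriv.restrHom_sec ..))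

theorem extends_iff_exists_sec (τ : ∀ i, LocalTriv T C i) (s : H0 D) :
    T.Extends s ↔ ∃ z : ∀ i, Sec L (C.U i),
      (∀ i (W : T.tot.Opens) (h : T.incl ⁻¹ᵁ W ≤ C.U i) x,
        T.conn.br W x ((τ i).sec h (rm L le_top s.1) (rm L h (z i))) = 0) ∧
      ∀ i j (W : T.tot.Opens) (hi : T.incl ⁻¹ᵁ W ≤ C.U i) (hj : T.incl ⁻¹ᵁ W ≤ C.U j),
        (τ i).sec hi (rm L le_top s.1) (rm L hi (z i)) =
          (τ j).sec hj (rm L le_top s.1) (rm L hj (z j)) := by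
  constructor
  · rintro ⟨t, ht⟩
    choose z hz using fun i => (τ i).exists_forall_rm_eq_sec (t := t.1) ht
    exact ⟨z, fun i W h x => (hz i W h) ▸ t.2 W x,
      fun i j W hi hj => (hz i W hi).symm.trans (hz j W hj)⟩
  · rintro ⟨z, hflat, hcompat⟩
    obtain ⟨t, hts, ht⟩ := exists_restrHom_eq_of_compatible τ s.1 z hcompat
    obtain ⟨W, hW, hcover⟩ := T.exists_cover_preimage_eq C
    refine ⟨⟨t, (mem_H0_iff_of_cover T.conn hcover t).2 fun i V hV x => ?_⟩, hts⟩
    rw [ht i V ((T.incl.preimage_mono hV).trans (hW i).le)]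
    exact hflat ..

namespace IsCocycleOf

variable {τ : ∀ i, LocalTriv T C i} {c : CochE f C} (hc : T.IsCocycleOf C τ c) {W : T.tot.Opens}
include hc

theorem sec_change (i j : ι) (hi : T.incl ⁻¹ᵁ W ≤ C.U i) (hj : T.incl ⁻¹ᵁ W ≤ C.U j)
    (s z : Sec L (T.incl ⁻¹ᵁ W)) :
    (τ j).sec hj s z =
      (τ i).sec hi s (z + M0At C j _ hj ((c.2 i j).1 j ⟨_, le_inf hi hj, hj⟩) s) := by
  rw [LocalTriv.sec, LocalTriv.sec, hc.trans i j W hi hj, smul_smul, (τ j).fn_eq_add_eps_mul,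
    hc.change i j W hi hj, hc.change i j W hi hj, LocalTriv.cst_eps_mul_fn, LocalTriv.fn_add,
    LocalTriv.fn_mul, C.coord_trans i j _ hi hj, C.coord_trans i j _ hi hj (z + _), C.coord_add,
    coord_M0At]
  congr 2 <;> ring

theorem poisson_br_fn (i : ι) (h : T.incl ⁻¹ᵁ W ≤ C.U i) (a b b' : Fn X (T.incl ⁻¹ᵁ W)) :
    T.poisson.br W ((τ i).fn W h a 0) ((τ i).fn W h b b') =
      (τ i).fn W h (P.br _ a b) (P.br _ a b' + ((c.1 i).1 i ⟨_, h, h⟩).2 b a) := by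
  rw [(τ i).fn_eq_add_eps_mul h b b', T.poisson.add_right, T.poisson.const_right, hc.poisson,
    hc.poisson, LocalTriv.cst_eps_mul_fn, LocalTriv.fn_add, ((c.1 i).2.1 i _ h h).2.skew a, neg_neg,
    add_zero, add_comm (P.br _ a b')]

theorem conn_br_sec (i : ι) (h : T.incl ⁻¹ᵁ W ≤ C.U i) (a : Fn X (T.incl ⁻¹ᵁ W))
    (s z : Sec L (T.incl ⁻¹ᵁ W)) :
    T.conn.br W ((τ i).fn W h a 0) ((τ i).sec h s z) =
      (τ i).sec h (D.br _ a s)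
        (D.br _ a z + M1At C i _ h ((c.1 i).1 i ⟨_, h, h⟩) s a) := by
  rw [LocalTriv.sec, LocalTriv.sec, T.conn.leibniz_right, hc.poisson_br_fn, hc.conn, smul_smul,
    ← add_smul, LocalTriv.fn_mul, LocalTriv.fn_add, C.coord_add, coord_br, coord_br, coord_M1At]
  congr 2
  ring

theorem conn_br_sec_eq_zero_iff (i : ι) (h : T.incl ⁻¹ᵁ W ≤ C.U i)
    {s : Sec L (T.incl ⁻¹ᵁ W)} (hs : ∀ a, D.br _ a s = 0) (z : Sec L (T.incl ⁻¹ᵁ W)) :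
    (∀ x, T.conn.br W x ((τ i).sec h s z) = 0) ↔
      ∀ a, D.br _ a z + M1At C i _ h ((c.1 i).1 i ⟨_, h, h⟩) s a = 0 := by
  rw [(τ i).br_eq_zero_iff h]
  refine forall_congr' fun a => ?_
  rw [hc.conn_br_sec, hs, ← (τ i).sec_zero h, LocalTriv.sec_inj, and_iff_right rfl]

theorem sec_eq_sec_iff (i j : ι) (hi : T.incl ⁻¹ᵁ W ≤ C.U i) (hj : T.incl ⁻¹ᵁ W ≤ C.U j)
    (s z z' : Sec L (T.incl ⁻¹ᵁ W)) :
    (τ i).sec hi s z = (τ j).sec hj s z' ↔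
      z' + M0At C j _ hj ((c.2 i j).1 j ⟨_, le_inf hi hj, hj⟩) s = z := by
  rw [hc.sec_change i j hi hj, LocalTriv.sec_inj, and_iff_right rfl, eq_comm]

theorem extends_iff (s : H0 D) : T.Extends s ↔ MCoch C c s.1 ∈ B1L D C := by
  rw [extends_iff_exists_sec τ, MCoch_mem_B1L_iff]
  simp only [hc.conn_br_sec_eq_zero_iff _ _ (H0_flat D s _), hc.sec_eq_sec_iff]
  refine exists_congr fun z => ⟨fun ⟨hflat, hglue⟩ => ⟨fun i V => ?_, fun i j V => ?_⟩,
    fun ⟨hflat, hglue⟩ => ⟨fun i W => hflat i _, fun i j W => hglue i j _⟩⟩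
  · obtain ⟨W, rfl⟩ := exists_preimage_eq T.incl V
    exact hflat i W
  · obtain ⟨W, rfl⟩ := exists_preimage_eq T.incl V
    exact hglue i j W

end IsCocycleOf

end FirstOrderDeformation

end PoissonDeformation

theorem mainTheorem11_general {k : Type u} [Field k] {X : Scheme.{u}} {f : X ⟶ Spec (.of k)}
    {P : PoissonStructure f} {L : X.Modules} {D : FlatPoissonConnection P L}
    {ι : Type v} {C : FramedCover L ι} (T : FirstOrderDeformation P D) {η : H1E D C}
    (hη : T.IsDefinedBy C η) (s : H0 D) :
    T.Extends s ↔ M1 D C η s = 0 := by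
  obtain ⟨τ, c, hc, rfl⟩ := hη
  rw [hc.extends_iff s, M1_mk_apply_eq_zero_iff]

theorem mainTheorem11 {k : Type u} [Field k] [IsAlgClosed k] [CharZero k]
    {X : Scheme.{u}} (f : X ⟶ Spec (.of k)) [IsIntegral X] [Smooth f]
    (hX : IsProjectiveOver k f) (P : PoissonStructure f)
    (L : X.Modules) (hL : IsInvertibleSheaf L) (D : FlatPoissonConnection P L)
    {ι : Type v} (C : FramedCover L ι)
    (T : FirstOrderDeformation P D) (η : H1E D C) (hη : T.IsDefinedBy C η) (s : H0 D) :
    T.Extends s ↔ M1 D C η s = 0 :=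
  mainTheorem11_general T hη s
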